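/- Let $\Omega\subseteq\mathbb C^n$ be a bounded domain (a nonempty, bounded, connected open set) and let $B=\{w\in\mathbb C^n:|w|<1\}$ be the Euclidean unit ball. For $z\in\Omega$ let $$\mathcal C(z)=\sup\{|\det\varphi'(z)| : \varphi:\Omega\to B \text{ holomorphic},\ \varphi(z)=0\},$$ $$\mathcal K(z)=\inf\Big\{\frac1{|\det\psi'(0)|} : \psi:B\to\Omega \text{ holomorphic},\ \psi(0)=z\Big\}$$ (with $1/0=\infty$) be the Carathéodory and Kobayashi volume elements, where $\varphi'$ and $\psi'$ denote complex Jacobian matrices, and let $\mathcal M(z)=\mathcal K(z)/\mathcal C(z)$ be the quotient invariant. If there is a point $P\in\Omega$ such that $\mathcal M(P)=1$, then $\mathcal M(z)=1$ for all $z\in\Omega$. If there is a point $P\in\Omega$ such that $\mathcal M(P)>1$, then $\mathcal M(z)>1$ for all $z\in\Omega$. Consequently $\mathcal M$ either equals $1$ everywhere on $\Omega$ or exceeds $1$ everywhere on $\Omega$. -/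

import Mathlib

open scoped ENNReal

/-- The open Euclidean unit ball `B` of `ℂⁿ`. -/
def unitBall (n : ℕ) : Set (EuclideanSpace ℂ (Fin n)) := Metric.ball 0 1

/-- `IsHolomorphicMap U V f`: the restriction of `f` to the open set `U` is a holomorphic mapping
from `U` to `V`. Only the values of `f` on `U` matter. -/
def IsHolomorphicMap {n : ℕ} (U V : Set (EuclideanSpace ℂ (Fin n)))
    (f : EuclideanSpace ℂ (Fin n) → EuclideanSpace ℂ (Fin n)) : Prop :=
  DifferentiableOn ℂ f U ∧ Set.MapsTo f U V

/-- The modulus `|det f'(z)|` of the complex Jacobian determinant, as an element of `[0, ∞]`. -/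
noncomputable def absJacobian {n : ℕ}
    (f : EuclideanSpace ℂ (Fin n) → EuclideanSpace ℂ (Fin n))
    (z : EuclideanSpace ℂ (Fin n)) : ℝ≥0∞ :=
  ‖(fderiv ℂ f z).det‖ₑ

/-- The Carathéodory volume element: the supremum of `|det φ'(z)|` over all holomorphic
`φ : Ω → B` with `φ(z) = 0`. -/
noncomputable def caratheodoryVolume {n : ℕ} (Ω : Set (EuclideanSpace ℂ (Fin n)))
    (z : EuclideanSpace ℂ (Fin n)) : ℝ≥0∞ :=
  sSup {c | ∃ φ : EuclideanSpace ℂ (Fin n) → EuclideanSpace ℂ (Fin n),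
    IsHolomorphicMap Ω (unitBall n) φ ∧ φ z = 0 ∧ c = absJacobian φ z}

/-- The Kobayashi volume element: the infimum of `1 / |det ψ'(0)|` over all holomorphic
`ψ : B → Ω` with `ψ(0) = z`, where `1 / 0 = ∞`. -/
noncomputable def kobayashiVolume {n : ℕ} (Ω : Set (EuclideanSpace ℂ (Fin n)))
    (z : EuclideanSpace ℂ (Fin n)) : ℝ≥0∞ :=
  sInf {c | ∃ ψ : EuclideanSpace ℂ (Fin n) → EuclideanSpace ℂ (Fin n),
    IsHolomorphicMap (unitBall n) Ω ψ ∧ ψ 0 = z ∧ c = 1 / absJacobian ψ 0}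

/-- The quotient invariant `𝓜 = 𝒦 / 𝒞`. -/
noncomputable def quotientInvariant {n : ℕ} (Ω : Set (EuclideanSpace ℂ (Fin n)))
    (z : EuclideanSpace ℂ (Fin n)) : ℝ≥0∞ :=
  kobayashiVolume Ω z / caratheodoryVolume Ω z

/-! By the Schwarz lemma `φ ∘ ψ` has derivative of norm at most one at `0`, hence `|det| ≤ 1`, so `𝓜
≥ 1` everywhere. Everything therefore reduces to carrying `𝓜 = 1` from `P` to an arbitrary `z`.

If `𝓜(P) = 1`, there are `φ_j : Ω → B` and `ψ_j : B → Ω` centred at `P` whose Jacobian products tend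
to `1`. Limits of the derivatives multiply to a contraction with determinant of modulus one, i.e. a
unitary map. Inserting its adjoint `U` gives self-maps `H_j = ψ_j ∘ U ∘ φ_j` of `Ω` that fix `P` and
whose derivatives there tend to the identity (`exists_contraction_tendsto_one`). A quantitative
Cartan uniqueness theorem (`uniform_near_id_of_fderiv_tendsto_one`) gives `H_j → id` near `P`, and a
Vitali argument (`uniform_small_near_of_isPreconnected`) spreads this to every point.

Near `z`, some `y` close to `z` satisfies `H_j y = z`. A ball automorphism moves `φ_j y` to the
origin, and a small correction recentres at `z` itself (`exists_centered_of_comp_near_id`). The new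
pair has Jacobian product close to `1`, so `𝓜(z) = 1`. No extremal maps are needed, only nearly
extremal ones. -/

open Metric Set Filter Topology

/-! ### Cauchy estimates for bounded holomorphic maps. -/

section CauchyEstimates

variable {E F : Type*} [NormedAddCommGroup E] [NormedSpace ℂ E]
  [NormedAddCommGroup F] [NormedSpace ℂ F]

theorem norm_fderiv_le_of_norm_le_on_ball {f : E → F} {c : E} {r M : ℝ} (hr : 0 < r)
    (hd : DifferentiableOn ℂ f (ball c r)) (hM : ∀ x ∈ ball c r, ‖f x‖ ≤ M) :
    ‖fderiv ℂ f c‖ ≤ 2 * M / r := by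
  refine Complex.norm_fderiv_le_div_of_mapsTo_ball hd (fun x hx => ?_) hr
  rw [mem_closedBall, dist_eq_norm]
  linarith [norm_sub_le (f x) (f c), hM x hx, hM c (mem_ball_self hr)]

theorem norm_sub_le_of_norm_le_on_ball {f : E → F} {c : E} {r M : ℝ} (hr : 0 < r)
    (hd : DifferentiableOn ℂ f (ball c r)) (hM : ∀ x ∈ ball c r, ‖f x‖ ≤ M)
    {a b : E} (ha : a ∈ ball c (r / 2)) (hb : b ∈ ball c (r / 2)) :
    ‖f b - f a‖ ≤ 4 * M / r * ‖b - a‖ := by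
  refine (convex_ball c (r / 2)).norm_image_sub_le_of_norm_fderiv_le (𝕜 := ℂ) (fun x hx => ?_)
    (fun x hx => ?_) ha hb
  · exact hd.differentiableAt (isOpen_ball.mem_nhds (ball_subset_ball (by linarith) hx))
  · have hsub : ball x (r / 2) ⊆ ball c r :=
      ball_subset_ball' (by linarith [mem_ball.1 hx])
    refine (norm_fderiv_le_of_norm_le_on_ball (half_pos hr) (hd.mono hsub)
      (fun y hy => hM y (hsub hy))).trans_eq ?_
    field_simp
    ring

/-- The difference `f (x + (b - a)) - f x` is already `O(‖b - a‖)`. The Cauchy estimate for it on a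
ball of radius `r / 4` gives the constant `32 = 2 * 4 * 4`. -/
theorem norm_fderiv_sub_le_of_norm_le_on_ball {f : E → F} {c : E} {r M : ℝ} (hr : 0 < r)
    (hd : DifferentiableOn ℂ f (ball c r)) (hM : ∀ x ∈ ball c r, ‖f x‖ ≤ M)
    {a b : E} (ha : a ∈ ball c (r / 4)) (hb : b ∈ ball c (r / 4)) :
    ‖fderiv ℂ f b - fderiv ℂ f a‖ ≤ 32 * M / r ^ 2 * ‖b - a‖ := by
  have hmem {x p : E} (hx : x ∈ ball a (r / 4)) (hp : p ∈ ball c (r / 4)) :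
      x + (p - a) ∈ ball c (r / 2) := by
    rw [mem_ball, dist_eq_norm] at *
    calc ‖x + (p - a) - c‖ = ‖(x - a) + (p - c)‖ := by congr 1; abel
      _ ≤ ‖x - a‖ + ‖p - c‖ := norm_add_le _ _
      _ < r / 2 := by linarith
  have hmem' {x : E} (hx : x ∈ ball a (r / 4)) : x ∈ ball c (r / 2) := by
    simpa using hmem hx ha
  have hdiff {x : E} (hx : x ∈ ball c (r / 2)) : DifferentiableAt ℂ f x :=
    hd.differentiableAt (isOpen_ball.mem_nhds (ball_subset_ball (by linarith) hx))
  have hshift {x : E} (hx : x ∈ ball a (r / 4)) :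
      HasFDerivAt (fun x => f (x + (b - a)) - f x)
        (fderiv ℂ f (x + (b - a)) - fderiv ℂ f x) x := by
    refine HasFDerivAt.sub ?_ (hdiff (hmem' hx)).hasFDerivAt
    exact (hasFDerivAt_comp_add_right (b - a)).2 (hdiff (hmem hx hb)).hasFDerivAt
  have hself : a ∈ ball a (r / 4) := mem_ball_self (by linarith)
  have := norm_fderiv_le_of_norm_le_on_ball (f := fun x => f (x + (b - a)) - f x) (c := a)
    (r := r / 4) (M := 4 * M / r * ‖b - a‖) (by linarith)
    (fun x hx => (hshift hx).differentiableAt.differentiableWithinAt) (fun x hx => by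
      simpa using norm_sub_le_of_norm_le_on_ball hr hd hM (hmem' hx) (hmem hx hb))
  rw [(hshift hself).fderiv] at this
  simp only [add_sub_cancel] at this
  refine this.trans_eq ?_
  field_simp
  ring

end CauchyEstimates

/-! ### Propagation of uniform smallness. -/

section Propagation

variable {E F : Type*} [NormedAddCommGroup E] [NormedSpace ℂ E]
  [NormedAddCommGroup F] [NormedSpace ℂ F]

/-- A bounded holomorphic function on a disc that is small near the centre is small well inside. -/
theorem exists_norm_le_of_small_near_center [CompleteSpace F] (M : ℝ) {s ε : ℝ} (hM : 0 ≤ M)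
    (hs : 0 < s) (hs2 : s < 2) (hε : 0 < ε) :
    ∃ δ > 0, ∀ g : ℂ → F, DifferentiableOn ℂ g (ball 0 2) → (∀ z ∈ ball 0 2, ‖g z‖ ≤ M) →
      (∀ z, ‖z‖ ≤ s → ‖g z‖ ≤ δ) → ‖g 1‖ ≤ ε := by
  have hsum : Summable fun n : ℕ => M * (2 / 3 : ℝ) ^ n :=
    (summable_geometric_of_lt_one (by norm_num) (by norm_num)).mul_left M
  -- Cauchy's inequalities on radii `3 / 2` and `s` bound the `n`-th Taylor term at `1` by this
  -- minimum. The sum tends to `0` with `δ` by dominated convergence, so `δ` can be chosen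
  -- independently of `g`.
  have hlim : Tendsto (fun δ : ℝ => ∑' n : ℕ, min (M * (2 / 3 : ℝ) ^ n) (δ / s ^ n)) (𝓝[>] 0)
      (𝓝 (∑' _ : ℕ, (0 : ℝ))) := by
    refine tendsto_tsum_of_dominated_convergence hsum (fun n => ?_) ?_
    · have h : Tendsto (fun δ : ℝ => min (M * (2 / 3 : ℝ) ^ n) (δ / s ^ n)) (𝓝 0)
          (𝓝 (min (M * (2 / 3 : ℝ) ^ n) (0 / s ^ n))) :=
        Continuous.tendsto (by fun_prop) 0
      have h0 : min (M * (2 / 3 : ℝ) ^ n) (0 / s ^ n) = 0 := by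
        rw [zero_div]
        exact min_eq_right (by positivity)
      rw [h0] at h
      exact h.mono_left nhdsWithin_le_nhds
    · filter_upwards [self_mem_nhdsWithin] with δ hδ n
      have hδ' : (0 : ℝ) < δ := hδ
      rw [Real.norm_of_nonneg (by positivity)]
      exact min_le_left _ _
  rw [tsum_zero] at hlim
  obtain ⟨δ, hδε, hδ⟩ := ((hlim.eventually (gt_mem_nhds hε)).and self_mem_nhdsWithin).exists
  have hδ' : (0 : ℝ) < δ := hδ
  refine ⟨δ, hδ', fun g hg hgM hgs => ?_⟩
  have hcoef (n : ℕ) :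
      ‖((n.factorial : ℂ)⁻¹ • ((1 : ℂ) - 0) ^ n • iteratedDeriv n g 0)‖ ≤
        min (M * (2 / 3 : ℝ) ^ n) (δ / s ^ n) := by
    have hfac : (0 : ℝ) < n.factorial := by positivity
    have key (R C : ℝ) (hR : 0 < R) (hR2 : R < 2) (hC : ∀ z ∈ sphere (0 : ℂ) R, ‖g z‖ ≤ C) :
        ‖((n.factorial : ℂ)⁻¹ • ((1 : ℂ) - 0) ^ n • iteratedDeriv n g 0)‖ ≤ C / R ^ n := by
      have h := Complex.norm_iteratedDeriv_le_of_forall_mem_sphere_norm_le n hR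
        (hg.diffContOnCl_ball (closedBall_subset_ball hR2)) hC
      rw [sub_zero, one_pow, one_smul, norm_smul, norm_inv, Complex.norm_natCast,
        inv_mul_le_iff₀ hfac]
      exact h.trans_eq (mul_div_assoc _ _ _)
    refine le_min ?_ (key s δ hs hs2 fun z hz => hgs z (by simpa using hz.le))
    refine (key (3 / 2) M (by norm_num) (by norm_num) fun z hz => hgM z ?_).trans_eq ?_
    · simp only [mem_sphere_iff_norm, sub_zero] at hz
      simp only [mem_ball_zero_iff, hz]
      norm_num
    · rw [div_eq_mul_inv, ← inv_pow]
      norm_num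
  have hsum' : Summable fun n : ℕ => min (M * (2 / 3 : ℝ) ^ n) (δ / s ^ n) :=
    hsum.of_nonneg_of_le (fun n => by positivity) (fun n => min_le_left _ _)
  have h1 := Complex.hasSum_taylorSeries_on_ball hg (z := 1) (by simp)
  rw [← h1.tsum_eq]
  exact (tsum_of_norm_bounded hsum'.hasSum hcoef).trans hδε.le

/-- Each complex line `ζ ↦ c + ζ • (x - c)` through the centre reaches `x` at `ζ = 1`, which reduces
the claim to the one-variable statement with a `δ` common to all lines. -/
theorem uniform_small_on_ball [CompleteSpace F] {ι : Type*} {l : Filter ι} {f : ι → E → F}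
    {c : E} {s ρ M : ℝ}
    (hs : 0 < s) (hρ : 0 < ρ) (hM : 0 ≤ M)
    (hd : ∀ j, DifferentiableOn ℂ (f j) (ball c (2 * ρ)))
    (hbd : ∀ j, ∀ x ∈ ball c (2 * ρ), ‖f j x‖ ≤ M)
    (hsmall : ∀ ε > 0, ∀ᶠ j in l, ∀ x ∈ ball c s, ‖f j x‖ ≤ ε) :
    ∀ ε > 0, ∀ᶠ j in l, ∀ x ∈ ball c ρ, ‖f j x‖ ≤ ε := by
  intro ε hε
  have ht : 0 < min (s / ρ) 1 := lt_min (by positivity) one_pos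
  obtain ⟨δ, hδ, H⟩ := exists_norm_le_of_small_near_center (F := F) M hM ht
    (lt_of_le_of_lt (min_le_right _ _) (by norm_num)) hε
  filter_upwards [hsmall δ hδ] with j hj x hx
  rw [mem_ball, dist_eq_norm] at hx
  have hline (ζ : ℂ) (hζ : ζ ∈ ball (0 : ℂ) 2) : c + ζ • (x - c) ∈ ball c (2 * ρ) := by
    rw [mem_ball_zero_iff] at hζ
    rw [mem_ball, dist_eq_norm, add_sub_cancel_left, norm_smul]
    exact mul_lt_mul'' hζ hx (norm_nonneg _) (norm_nonneg _)
  have := H (fun ζ => f j (c + ζ • (x - c)))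
    ((hd j).comp (by fun_prop) hline) (fun ζ hζ => hbd j _ (hline ζ hζ)) (fun ζ hζ => by
      refine hj _ ?_
      rw [mem_ball, dist_eq_norm, add_sub_cancel_left, norm_smul]
      calc ‖ζ‖ * ‖x - c‖ ≤ s / ρ * ‖x - c‖ :=
            mul_le_mul_of_nonneg_right (hζ.trans (min_le_left _ _)) (norm_nonneg _)
        _ < s / ρ * ρ := mul_lt_mul_of_pos_left hx (by positivity)
        _ = s := by field_simp)
  simpa using this

/-- **Vitali-type propagation**: a uniformly bounded family of holomorphic maps on a connected open
set that tends to zero uniformly near one point tends to zero uniformly near every point. -/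
theorem uniform_small_near_of_isPreconnected [CompleteSpace F] {ι : Type*} {l : Filter ι}
    {f : ι → E → F} {Ω : Set E} (hΩ : IsOpen Ω) (hconn : IsPreconnected Ω) {M : ℝ} (hM : 0 ≤ M)
    (hd : ∀ j, DifferentiableOn ℂ (f j) Ω) (hbd : ∀ j, ∀ x ∈ Ω, ‖f j x‖ ≤ M)
    {P : E} (hP : P ∈ Ω)
    (hsmall : ∃ s > 0, ∀ ε > 0, ∀ᶠ j in l, ∀ x ∈ ball P s, ‖f j x‖ ≤ ε) {z : E} (hz : z ∈ Ω) :
    ∃ s > 0, ∀ ε > 0, ∀ᶠ j in l, ∀ x ∈ ball z s, ‖f j x‖ ≤ ε := by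
  set S : Set E := {z | ∃ s > 0, ∀ ε > 0, ∀ᶠ j in l, ∀ x ∈ ball z s, ‖f j x‖ ≤ ε}
  have hSopen : IsOpen S := by
    rw [Metric.isOpen_iff]
    rintro w ⟨s, hs, hw⟩
    refine ⟨s / 2, half_pos hs, fun y hy => ⟨s / 2, half_pos hs, fun ε hε => ?_⟩⟩
    filter_upwards [hw ε hε] with j hj x hx
    exact hj x (ball_subset_ball' (by linarith [mem_ball.1 hy]) hx)
  refine hconn.subset_of_closure_inter_subset hSopen ⟨P, hP, hsmall⟩ ?_ hz
  rintro y ⟨hy, hyΩ⟩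
  obtain ⟨R, hR, hRΩ⟩ := Metric.isOpen_iff.1 hΩ y hyΩ
  -- With `dist y w < R / 4`, the ball of radius `2R / 3` about `w` stays in `ball y R`, while the
  -- one of radius `R / 3` still contains `ball y (R / 12)`.
  obtain ⟨w, ⟨s, hs, hw⟩, hyw⟩ := mem_closure_iff.1 hy (R / 4) (by linarith)
  have hsub : ball w (2 * (R / 3)) ⊆ Ω :=
    (ball_subset_ball' (by rw [dist_comm]; linarith)).trans hRΩ
  have := uniform_small_on_ball hs (by linarith : 0 < R / 3) hM (fun j => (hd j).mono hsub)
    (fun j x hx => hbd j x (hsub hx)) hw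
  refine ⟨R / 12, by linarith, fun ε hε => ?_⟩
  filter_upwards [this ε hε] with j hj x hx
  exact hj x (ball_subset_ball' (by linarith) hx)

end Propagation

/-! ### Quantitative Cartan uniqueness. -/

section Cartan

variable {E : Type*} [NormedAddCommGroup E] [NormedSpace ℂ E]

/-- A bounded holomorphic map whose derivative at `P` is close to the identity is expanding, up to
a factor `2`, on a ball around `P` whose radius depends only on the bound. -/
theorem exists_norm_sub_le_two_mul {r : ℝ} (hr : 0 < r) {M : ℝ} (hM : 0 ≤ M) :
    ∃ δ > 0, δ ≤ r ∧ ∀ (P : E) (f : E → E), DifferentiableOn ℂ f (ball P r) →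
      (∀ x ∈ ball P r, ‖f x‖ ≤ M) → ‖fderiv ℂ f P - 1‖ ≤ 1 / 4 →
      ∀ a ∈ ball P δ, ∀ b ∈ ball P δ, ‖b - a‖ ≤ 2 * ‖f b - f a‖ := by
  -- On this radius the bound `32 * M / r ^ 2` for the variation of the derivative costs at most `1
  -- / 4`, keeping it within `1 / 2` of the identity. Using `M + 1` covers `M = 0`.
  have hδ : 0 < min (r / 4) (r ^ 2 / (128 * (M + 1))) := lt_min (by linarith) (by positivity)
  have hδr : min (r / 4) (r ^ 2 / (128 * (M + 1))) ≤ r / 4 := min_le_left _ _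
  refine ⟨_, hδ, by linarith, fun P f hd hbd hP a ha b hb => ?_⟩
  have hderiv : ∀ x ∈ ball P (min (r / 4) (r ^ 2 / (128 * (M + 1)))),
      ‖fderiv ℂ f x - 1‖ ≤ 1 / 2 := by
    intro x hx
    have h1 := norm_fderiv_sub_le_of_norm_le_on_ball hr hd hbd (mem_ball_self (by linarith))
      (ball_subset_ball hδr hx)
    have h2 : ‖x - P‖ ≤ r ^ 2 / (128 * (M + 1)) := by
      rw [mem_ball, dist_eq_norm] at hx
      exact hx.le.trans (min_le_right _ _)
    have h3 : 32 * M / r ^ 2 * ‖x - P‖ ≤ 1 / 4 := by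
      calc 32 * M / r ^ 2 * ‖x - P‖ ≤ 32 * M / r ^ 2 * (r ^ 2 / (128 * (M + 1))) := by gcongr
        _ = 1 / 4 * (M / (M + 1)) := by field_simp; ring
        _ ≤ 1 / 4 * 1 := by
          gcongr
          rw [div_le_one (by positivity)]
          linarith
        _ = 1 / 4 := mul_one _
    have h4 := norm_add_le (fderiv ℂ f x - fderiv ℂ f P) (fderiv ℂ f P - 1)
    rw [sub_add_sub_cancel] at h4
    linarith
  have h := (convex_ball P (min (r / 4) (r ^ 2 / (128 * (M + 1))))
    ).norm_image_sub_le_of_norm_fderiv_le' (𝕜 := ℂ) (f := f) (fun x hx =>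
      hd.differentiableAt (isOpen_ball.mem_nhds (ball_subset_ball (by linarith) hx))) hderiv ha hb
  rw [one_apply_eq_self, norm_sub_rev] at h
  have h5 := norm_add_le (b - a - (f b - f a)) (f b - f a)
  rw [sub_add_cancel] at h5
  linarith

/-- **Cartan's uniqueness theorem**, asymptotic form: holomorphic self-maps of a bounded open set
that fix `P` and whose derivatives at `P` tend to the identity tend to the identity near `P`. -/
theorem uniform_near_id_of_fderiv_tendsto_one {ι : Type*} {l : Filter ι} {Ω : Set E}
    (hΩ : IsOpen Ω) {M : ℝ} (hbd : ∀ x ∈ Ω, ‖x‖ ≤ M) {P : E} (hP : P ∈ Ω) {h : ι → E → E}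
    (hd : ∀ j, DifferentiableOn ℂ (h j) Ω) (hmaps : ∀ j, MapsTo (h j) Ω Ω)
    (hfix : ∀ j, h j P = P) (hlim : Tendsto (fun j => fderiv ℂ (h j) P) l (𝓝 1)) :
    ∃ s > 0, ∀ ε > 0, ∀ᶠ j in l, ∀ x ∈ ball P s, ‖h j x - x‖ ≤ ε := by
  have hM : 0 ≤ M := (norm_nonneg P).trans (hbd P hP)
  obtain ⟨r, hr, hrΩ⟩ := Metric.isOpen_iff.1 hΩ P hP
  obtain ⟨δ, hδ, hδr, H⟩ := exists_norm_sub_le_two_mul (E := E) hr hM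
  set C : ℝ := 4 * M / r
  have hC : 0 ≤ C := by positivity
  -- `C` is a Lipschitz constant of every `h j` on `ball P (r / 2)`, so `h j x` stays in the ball of
  -- radius `δ` where the average is expanding.
  refine ⟨min (r / 2) (δ / (C + 1)), lt_min (by linarith) (by positivity), fun ε hε => ?_⟩
  -- For the average `A` of `k` iterates, `A (h x) - A x` telescopes to `(h^[k] x - x) / k`, of norm
  -- at most `2 * M / k`. Since `A` is expanding up to a factor `2`, `‖h x - x‖ ≤ 4 * M / k`.
  obtain ⟨k, hk⟩ := exists_nat_gt (4 * M / ε)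
  have hkpos : 0 < k := by
    have : (0 : ℝ) < k := lt_of_le_of_lt (by positivity) hk
    exact_mod_cast this
  have hk' : (0 : ℝ) < k := by exact_mod_cast hkpos
  -- the averages of the first `k` iterates
  let A : ι → E → E := fun j x => (k : ℂ)⁻¹ • ∑ i ∈ Finset.range k, (h j)^[i] x
  have hiter (j : ι) (i : ℕ) : MapsTo (h j)^[i] Ω Ω := (hmaps j).iterate i
  have hiterd (j : ι) (i : ℕ) : DifferentiableOn ℂ (h j)^[i] Ω := by
    induction i with
    | zero => exact differentiableOn_id
    | succ i ih =>
      rw [Function.iterate_succ']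
      exact (hd j).comp ih (hiter j i)
  have hAd (j : ι) : DifferentiableOn ℂ (A j) Ω :=
    (DifferentiableOn.fun_sum fun i _ => hiterd j i).const_smul _
  have hAbd (j : ι) : ∀ x ∈ Ω, ‖A j x‖ ≤ M := by
    intro x hx
    rw [norm_smul, norm_inv, Complex.norm_natCast, inv_mul_le_iff₀ hk']
    refine (norm_sum_le_of_le _ (fun i _ => hbd _ (hiter j i hx))).trans_eq ?_
    simp
  have hAfd (j : ι) : fderiv ℂ (A j) P =
      (k : ℂ)⁻¹ • ∑ i ∈ Finset.range k, (fderiv ℂ (h j) P) ^ i := by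
    refine HasFDerivAt.fderiv (HasFDerivAt.const_smul (HasFDerivAt.fun_sum fun i _ => ?_) _)
    exact ((hd j).differentiableAt (hΩ.mem_nhds hP)).hasFDerivAt.iterate (hfix j) i
  have hAlim : Tendsto (fun j => fderiv ℂ (A j) P) l (𝓝 1) := by
    simp_rw [hAfd]
    have : Tendsto (fun j => (k : ℂ)⁻¹ • ∑ i ∈ Finset.range k, (fderiv ℂ (h j) P) ^ i) l
        (𝓝 ((k : ℂ)⁻¹ • ∑ i ∈ Finset.range k, (1 : E →L[ℂ] E) ^ i)) :=
      (tendsto_finsetSum _ fun i _ => hlim.pow i).const_smul _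
    have hk0 : (k : ℂ) ≠ 0 := by exact_mod_cast hkpos.ne'
    simpa [← Nat.cast_smul_eq_nsmul ℂ, smul_smul, hk0] using this
  have hev : ∀ᶠ j in l, ‖fderiv ℂ (A j) P - 1‖ ≤ 1 / 4 := by
    have := (hAlim.sub_const 1).norm
    rw [sub_self, norm_zero] at this
    filter_upwards [this.eventually (gt_mem_nhds (by norm_num : (0 : ℝ) < 1 / 4))] with j hj
    exact hj.le
  filter_upwards [hev] with j hj x hx
  have hxr : x ∈ ball P (r / 2) := ball_subset_ball (min_le_left _ _) hx
  have hxΩ : x ∈ Ω := hrΩ (ball_subset_ball (by linarith) hxr)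
  have hxδ' : ‖x - P‖ < δ / (C + 1) := by
    rw [← dist_eq_norm]
    exact (mem_ball.1 hx).trans_le (min_le_right _ _)
  have hxδ : x ∈ ball P δ := by
    rw [mem_ball, dist_eq_norm]
    exact hxδ'.trans_le (div_le_self hδ.le (by linarith))
  have hhx : h j x ∈ ball P δ := by
    have h1 := norm_sub_le_of_norm_le_on_ball hr ((hd j).mono hrΩ)
      (fun y hy => hbd _ (hmaps j (hrΩ hy))) (mem_ball_self (half_pos hr)) hxr
    rw [hfix j] at h1
    rw [mem_ball, dist_eq_norm]
    calc ‖h j x - P‖ ≤ C * ‖x - P‖ := h1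
      _ ≤ (C + 1) * ‖x - P‖ := by gcongr; linarith
      _ < (C + 1) * (δ / (C + 1)) := by gcongr
      _ = δ := by field_simp
  have h1 := H P (A j) ((hAd j).mono hrΩ) (fun y hy => hAbd j y (hrΩ hy)) hj x hxδ _ hhx
  have h2 : A j (h j x) - A j x = (k : ℂ)⁻¹ • ((h j)^[k] x - x) := by
    simp only [A, ← smul_sub, ← Finset.sum_sub_distrib, ← Function.iterate_succ_apply]
    rw [Finset.sum_range_sub (fun i => (h j)^[i] x)]
    rfl
  have h3 : ‖(h j)^[k] x - x‖ ≤ 2 * M := by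
    linarith [norm_sub_le ((h j)^[k] x) x, hbd x hxΩ, hbd _ (hiter j k hxΩ)]
  rw [h2, norm_smul, norm_inv, Complex.norm_natCast] at h1
  refine h1.trans ?_
  rw [div_lt_iff₀ hε] at hk
  calc 2 * ((k : ℝ)⁻¹ * ‖(h j)^[k] x - x‖) ≤ 2 * ((k : ℝ)⁻¹ * (2 * M)) := by gcongr
    _ = (4 * M) / k := by field_simp; ring
    _ ≤ ε := by
      rw [div_le_iff₀ hk']
      linarith

/-- A holomorphic map uniformly close to the identity on a ball attains the centre as a value near
the centre. -/
theorem exists_eq_center_of_near_id [CompleteSpace E] {f : E → E} {z : E} {r η : ℝ} (hr : 0 < r)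
    (hη : 8 * η < r) (hd : DifferentiableOn ℂ f (ball z r))
    (hf : ∀ x ∈ ball z r, ‖f x - x‖ ≤ η) :
    ∃ y, ‖y - z‖ ≤ 2 * ‖f z - z‖ ∧ f y = z := by
  have hz : ‖f z - z‖ ≤ η := hf z (mem_ball_self hr)
  have hη0 : 0 ≤ η := (norm_nonneg _).trans hz
  let N : ContinuousLinearMap.NonlinearRightInverse (ContinuousLinearMap.id ℂ E) :=
    { toFun := id, nnnorm := 1, bound' := by simp, right_inv' := by simp }
  have happ : ApproximatesLinearOn f (ContinuousLinearMap.id ℂ E) (ball z (r / 2)) (1 / 2) := by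
    intro x hx y hy
    have h := norm_sub_le_of_norm_le_on_ball (f := fun x => f x - x) hr
      (hd.sub differentiableOn_id) hf hy hx
    have h2 : 4 * η / r ≤ 1 / 2 := by
      rw [div_le_iff₀ hr]
      linarith
    calc ‖f x - f y - (ContinuousLinearMap.id ℂ E) (x - y)‖ = ‖f x - x - (f y - y)‖ := by
          congr 1
          simp only [ContinuousLinearMap.id_apply]
          abel
      _ ≤ 4 * η / r * ‖x - y‖ := h
      _ ≤ 1 / 2 * ‖x - y‖ := by gcongr
      _ = _ := by simp
  -- The image of a closed ball of radius `ρ` about `z` contains the one of radius `(1 - 1 / 2) * ρ`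
  -- about `f z`; `ρ = 2 * ‖f z - z‖` just reaches `z`.
  have hsurj := happ.surjOn_closedBall_of_nonlinearRightInverse N
    (ε := 2 * ‖f z - z‖) (b := z) (by positivity)
    (closedBall_subset_ball (by linarith))
  obtain ⟨y, hy, hfy⟩ := hsurj (a := z) (by
    rw [mem_closedBall, dist_comm, dist_eq_norm]
    simp only [N]
    norm_num
    linarith)
  exact ⟨y, by rwa [mem_closedBall, dist_eq_norm] at hy, hfy⟩

end Cartan

/-! ### Determinants of contractions and the equality case. -/

section Contractions

variable {E : Type*} [NormedAddCommGroup E] [InnerProductSpace ℂ E] [FiniteDimensional ℂ E]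

open scoped InnerProductSpace in
-- Diagonalise the self-adjoint `T* T`: its eigenvalues are the squared singular values, and its
-- determinant is `|det T|²`.
theorem exists_orthonormalBasis_adjoint_mul_self (T : E →L[ℂ] E) :
    ∃ (b : OrthonormalBasis (Fin (Module.finrank ℂ E)) ℂ E),
      (∀ i, (ContinuousLinearMap.adjoint T) (T (b i)) = ((‖T (b i)‖ ^ 2 : ℝ) : ℂ) • b i) ∧
      ‖T.det‖ ^ 2 = ∏ i, ‖T (b i)‖ ^ 2 := by
  have hsym : ((ContinuousLinearMap.adjoint T ∘L T : E →L[ℂ] E) : E →ₗ[ℂ] E).IsSymmetric := by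
    intro x y
    simp [ContinuousLinearMap.adjoint_inner_left, ContinuousLinearMap.adjoint_inner_right]
  have heig (i : Fin (Module.finrank ℂ E)) :
      ContinuousLinearMap.adjoint T (T (hsym.eigenvectorBasis rfl i)) =
        (hsym.eigenvalues rfl i : ℂ) • hsym.eigenvectorBasis rfl i :=
    hsym.apply_eigenvectorBasis rfl i
  have hval (i : Fin (Module.finrank ℂ E)) :
      hsym.eigenvalues rfl i = ‖T (hsym.eigenvectorBasis rfl i)‖ ^ 2 := by
    have h1 : (⟪hsym.eigenvectorBasis rfl i,
        ContinuousLinearMap.adjoint T (T (hsym.eigenvectorBasis rfl i))⟫_ℂ) =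
        ((‖T (hsym.eigenvectorBasis rfl i)‖ ^ 2 : ℝ) : ℂ) := by
      rw [ContinuousLinearMap.adjoint_inner_right, inner_self_eq_norm_sq_to_K]
      norm_cast
    rw [heig, inner_smul_right, inner_self_eq_norm_sq_to_K,
      (hsym.eigenvectorBasis rfl).orthonormal.1 i] at h1
    norm_num at h1
    exact_mod_cast h1
  refine ⟨hsym.eigenvectorBasis rfl, fun i => by rw [heig, hval], ?_⟩
  have hdet := (T : E →ₗ[ℂ] E).toContinuousLinearMap.normDet_sq
  have h2 : (T : E →ₗ[ℂ] E).toContinuousLinearMap = T := by ext; rfl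
  rw [h2] at hdet
  have h3 := hsym.det_eq_prod_eigenvalues rfl
  rw [LinearMap.normDet_eq_norm_det] at hdet
  simp_rw [hval] at h3
  have h4 := hdet.trans h3
  exact_mod_cast h4

theorem norm_det_le_one {T : E →L[ℂ] E} (hT : ‖T‖ ≤ 1) : ‖T.det‖ ≤ 1 := by
  obtain ⟨b, -, hb⟩ := exists_orthonormalBasis_adjoint_mul_self T
  have : ‖T.det‖ ^ 2 ≤ 1 := by
    rw [hb]
    refine Finset.prod_le_one (fun i _ => by positivity) (fun i _ => ?_)
    refine pow_le_one₀ (norm_nonneg _) ?_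
    simpa using T.le_of_opNorm_le hT (b i)
  exact (sq_le_one_iff₀ (norm_nonneg _)).1 this

/-- Factors in `[0, 1]` with product `1` are all `1`, so every singular value is `1`. -/
theorem adjoint_mul_self_eq_one {T : E →L[ℂ] E} (hT : ‖T‖ ≤ 1) (hdet : ‖T.det‖ = 1) :
    ContinuousLinearMap.adjoint T * T = 1 := by
  obtain ⟨b, hb, hprod⟩ := exists_orthonormalBasis_adjoint_mul_self T
  have hle (i) : ‖T (b i)‖ ^ 2 ≤ 1 :=
    pow_le_one₀ (norm_nonneg _) (by simpa using T.le_of_opNorm_le hT (b i))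
  have h1 (i) : ‖T (b i)‖ ^ 2 = 1 := by
    refine le_antisymm (hle i) ?_
    have h2 : ∏ j, ‖T (b j)‖ ^ 2 = 1 := by rw [← hprod, hdet, one_pow]
    rw [← Finset.mul_prod_erase _ _ (Finset.mem_univ i)] at h2
    calc 1 = _ := h2.symm
      _ ≤ ‖T (b i)‖ ^ 2 * 1 := by
        gcongr
        exact Finset.prod_le_one (fun i _ => by positivity) (fun i _ => hle i)
      _ = _ := mul_one _
  have h3 : ((ContinuousLinearMap.adjoint T * T : E →L[ℂ] E) : E →ₗ[ℂ] E) = LinearMap.id := by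
    refine b.toBasis.ext fun i => ?_
    simp [hb, h1]
  ext x
  exact congrArg (fun f : E →ₗ[ℂ] E => f x) h3

end Contractions

/-! ### Automorphisms of the unit ball. -/

section BallAutomorphism

variable {E : Type*} [NormedAddCommGroup E] [InnerProductSpace ℂ E]

open scoped InnerProductSpace

/-- The involutive automorphism of the unit ball that exchanges `0` and `a`. -/
noncomputable def ballInvolution (a z : E) : E :=
  (1 - ⟪a, z⟫_ℂ)⁻¹ • (a - (√(1 - ‖a‖ ^ 2) : ℂ) • z -
    ((1 + √(1 - ‖a‖ ^ 2) : ℂ)⁻¹ * ⟪a, z⟫_ℂ) • a)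

variable {a z : E}

theorem one_sub_inner_ne_zero (ha : ‖a‖ < 1) (hz : ‖z‖ < 1) : 1 - ⟪a, z⟫_ℂ ≠ 0 := by
  intro h
  have h1 : ‖⟪a, z⟫_ℂ‖ < 1 := (norm_inner_le_norm a z).trans_lt
    (mul_lt_one_of_nonneg_of_lt_one_left (norm_nonneg _) ha hz.le)
  rw [← sub_eq_zero.1 h, norm_one] at h1
  exact lt_irrefl _ h1

theorem sqrt_one_sub_norm_sq_pos {E : Type*} [NormedAddCommGroup E] {a : E} (ha : ‖a‖ < 1) : 0 < √(1 - ‖a‖ ^ 2) :=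
  Real.sqrt_pos.2 (by nlinarith [norm_nonneg a])

theorem sq_sqrt_one_sub_norm_sq {E : Type*} [NormedAddCommGroup E] {a : E} (ha : ‖a‖ < 1) : √(1 - ‖a‖ ^ 2) ^ 2 = 1 - ‖a‖ ^ 2 :=
  Real.sq_sqrt (by nlinarith [norm_nonneg a])

theorem ballInvolution_zero (a : E) : ballInvolution a 0 = a := by
  simp [ballInvolution]

/-- With `s = √(1 - ‖a‖²)`, the coefficient `1 / (1 + s)` is the usual `(1 - s) / ‖a‖²` in a form
valid at `a = 0`. The claim becomes rational algebra in `s` and `t = ⟪a, z⟫`. -/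
theorem ballInvolution_involutive_on_ball (ha : ‖a‖ < 1) (hz : ‖z‖ < 1) :
    ballInvolution a (ballInvolution a z) = z := by
  have hs := sqrt_one_sub_norm_sq_pos ha
  have hs2 := sq_sqrt_one_sub_norm_sq ha
  have ht := one_sub_inner_ne_zero ha hz
  have hinner : ⟪a, ballInvolution a z⟫_ℂ =
      (1 - ⟪a, z⟫_ℂ)⁻¹ * ((‖a‖ : ℂ) ^ 2 - ⟪a, z⟫_ℂ) := by
    have hs' : (1 + (√(1 - ‖a‖ ^ 2) : ℂ)) ≠ 0 := by exact_mod_cast (by positivity : _ ≠ (0 : ℝ))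
    have haa : (‖a‖ : ℂ) ^ 2 = 1 - (√(1 - ‖a‖ ^ 2) : ℂ) ^ 2 := by
      have : ‖a‖ ^ 2 = 1 - √(1 - ‖a‖ ^ 2) ^ 2 := by linarith
      exact_mod_cast this
    simp only [ballInvolution, inner_smul_right, inner_sub_right, inner_self_eq_norm_sq_to_K]
    simp only [RCLike.ofReal_eq_complex_ofReal] at *
    generalize (√(1 - ‖a‖ ^ 2) : ℂ) = s at *
    rw [haa]
    congr 1
    field_simp
    ring
  rw [ballInvolution, hinner]
  rw [ballInvolution]
  have hs' : (1 + (√(1 - ‖a‖ ^ 2) : ℂ)) ≠ 0 := by exact_mod_cast (by positivity : _ ≠ (0 : ℝ))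
  have hs0 : (√(1 - ‖a‖ ^ 2) : ℂ) ≠ 0 := by exact_mod_cast hs.ne'
  have haa : (‖a‖ : ℂ) ^ 2 = 1 - (√(1 - ‖a‖ ^ 2) : ℂ) ^ 2 := by
    have : ‖a‖ ^ 2 = 1 - √(1 - ‖a‖ ^ 2) ^ 2 := by linarith
    exact_mod_cast this
  generalize (√(1 - ‖a‖ ^ 2) : ℂ) = s at *
  generalize ⟪a, z⟫_ℂ = t at *
  have hden : 1 - (1 - t)⁻¹ * ((‖a‖ : ℂ) ^ 2 - t) = (1 - t)⁻¹ * s ^ 2 := by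
    rw [haa]
    field_simp
    ring
  rw [hden, haa]
  match_scalars <;> field_simp
  ring

theorem ballInvolution_self (ha : ‖a‖ < 1) : ballInvolution a a = 0 := by
  simpa [ballInvolution_zero] using ballInvolution_involutive_on_ball (z := 0) ha (by simp)

/-- The squared norms of denominator and numerator differ by exactly `s² * (1 - ‖z‖²) > 0`, where
`s² = 1 - ‖a‖²`. -/
theorem norm_ballInvolution_lt_one (ha : ‖a‖ < 1) (hz : ‖z‖ < 1) : ‖ballInvolution a z‖ < 1 := by
  have hs := sqrt_one_sub_norm_sq_pos ha
  have hs2 := sq_sqrt_one_sub_norm_sq ha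
  have ht := one_sub_inner_ne_zero ha hz
  rw [ballInvolution, norm_smul, norm_inv, inv_mul_lt_one₀ (norm_pos_iff.2 ht)]
  refine lt_of_pow_lt_pow_left₀ 2 (norm_nonneg _) ?_
  generalize √(1 - ‖a‖ ^ 2) = s at *
  have h1 : (‖a - (s : ℂ) • z - ((1 + s : ℂ)⁻¹ * ⟪a, z⟫_ℂ) • a‖ : ℝ) ^ 2 =
      ‖a‖ ^ 2 + s ^ 2 * ‖z‖ ^ 2 + ‖⟪a, z⟫_ℂ‖ ^ 2 - 2 * (⟪a, z⟫_ℂ).re := by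
    have haa : ‖a‖ ^ 2 = 1 - s ^ 2 := by linarith
    have hc : ((1 + s : ℂ)⁻¹ * ⟪a, z⟫_ℂ) = (((1 + s)⁻¹ : ℝ) : ℂ) * ⟪a, z⟫_ℂ := by push_cast; rfl
    rw [hc]
    rw [@norm_sub_sq ℂ, @norm_sub_sq ℂ]
    simp only [inner_smul_right, inner_sub_left, inner_smul_left, norm_smul, norm_mul,
      Complex.norm_real, mul_pow, Real.norm_eq_abs, sq_abs, inner_self_eq_norm_sq_to_K]
    rw [← inner_conj_symm z a]
    generalize ⟪a, z⟫_ℂ = t at *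
    have h2 : ‖t‖ ^ 2 = t.re * t.re + t.im * t.im := by
      rw [← Complex.normSq_eq_norm_sq, Complex.normSq_apply]
    rw [h2]
    generalize hq : (1 + s)⁻¹ = q
    simp [← Complex.ofReal_pow, haa]
    rw [← hq]
    field_simp
    ring
  have h3 : ‖1 - ⟪a, z⟫_ℂ‖ ^ 2 = 1 - 2 * (⟪a, z⟫_ℂ).re + ‖⟪a, z⟫_ℂ‖ ^ 2 := by
    rw [@norm_sub_sq ℂ]
    simp
  rw [h1, h3]
  have h4 : 0 < s ^ 2 * (1 - ‖z‖ ^ 2) := by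
    have : 0 < 1 - ‖z‖ ^ 2 := by nlinarith [norm_nonneg z]
    positivity
  linarith

theorem differentiableOn_ballInvolution (ha : ‖a‖ < 1) :
    DifferentiableOn ℂ (ballInvolution a) (ball 0 1) := by
  have hin : Differentiable ℂ fun z : E => ⟪a, z⟫_ℂ := (innerSL ℂ a).differentiable
  intro z hz
  have ht := one_sub_inner_ne_zero ha (mem_ball_zero_iff.1 hz)
  refine DifferentiableAt.differentiableWithinAt ?_
  unfold ballInvolution
  exact (((differentiableAt_const _).sub hin.differentiableAt).inv ht).smul
    (((differentiableAt_const _).sub (differentiableAt_id.const_smul _)).sub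
      ((hin.differentiableAt.const_mul _).smul_const a))

end BallAutomorphism

/-! ### Volume elements and nearly extremal pairs. -/

section Volumes

variable {n : ℕ} {Ω : Set (EuclideanSpace ℂ (Fin n))} {z : EuclideanSpace ℂ (Fin n)}
  {φ ψ : EuclideanSpace ℂ (Fin n) → EuclideanSpace ℂ (Fin n)}

theorem zero_mem_unitBall (n : ℕ) : (0 : EuclideanSpace ℂ (Fin n)) ∈ unitBall n :=
  mem_ball_self one_pos

theorem fderiv_comp_eq_mul {E : Type*} [NormedAddCommGroup E] [NormedSpace ℂ E] {f g : E → E}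
    {U V : Set E} (hU : IsOpen U) (hV : IsOpen V) (hg : DifferentiableOn ℂ g V)
    (hf : DifferentiableOn ℂ f U) (hmaps : MapsTo f U V) {x : E} (hx : x ∈ U) :
    fderiv ℂ (g ∘ f) x = fderiv ℂ g (f x) * fderiv ℂ f x :=
  fderiv_comp x (hg.differentiableAt (hV.mem_nhds (hmaps hx)))
    (hf.differentiableAt (hU.mem_nhds hx))

/-- Schwarz lemma for `φ ∘ ψ`, a self-map of the ball fixing `0`. -/
theorem norm_fderiv_mul_fderiv_le_one (hΩ : IsOpen Ω) (hφ : IsHolomorphicMap Ω (unitBall n) φ)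
    (hψ : IsHolomorphicMap (unitBall n) Ω ψ) (hφz : φ z = 0) (hψ0 : ψ 0 = z) :
    ‖fderiv ℂ φ z * fderiv ℂ ψ 0‖ ≤ 1 := by
  have h := fderiv_comp_eq_mul isOpen_ball hΩ hφ.1 hψ.1 hψ.2 (zero_mem_unitBall n)
  rw [hψ0] at h
  rw [← h]
  refine Complex.norm_fderiv_le_one_of_mapsTo_ball (R := 1) (hφ.1.comp hψ.1 hψ.2) ?_ one_pos
  intro x hx
  simpa [hψ0, hφz] using ball_subset_closedBall (hφ.2 (hψ.2 hx))

theorem absJacobian_mul_absJacobian (φ ψ : EuclideanSpace ℂ (Fin n) → EuclideanSpace ℂ (Fin n))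
    (z w : EuclideanSpace ℂ (Fin n)) :
    absJacobian φ z * absJacobian ψ w = ‖(fderiv ℂ φ z * fderiv ℂ ψ w).det‖ₑ := by
  rw [absJacobian, absJacobian, ← enorm_mul]
  congr 1
  exact (map_mul LinearMap.det (fderiv ℂ φ z : EuclideanSpace ℂ (Fin n) →ₗ[ℂ] _)
    (fderiv ℂ ψ w : EuclideanSpace ℂ (Fin n) →ₗ[ℂ] _)).symm

theorem absJacobian_mul_le_one (hΩ : IsOpen Ω)
    (hφ : IsHolomorphicMap Ω (unitBall n) φ) (hψ : IsHolomorphicMap (unitBall n) Ω ψ)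
    (hφz : φ z = 0) (hψ0 : ψ 0 = z) : absJacobian φ z * absJacobian ψ 0 ≤ 1 := by
  rw [absJacobian_mul_absJacobian, ← ofReal_norm]
  exact ENNReal.ofReal_le_one.2 (norm_det_le_one (norm_fderiv_mul_fderiv_le_one hΩ hφ hψ hφz hψ0))

theorem caratheodoryVolume_le_kobayashiVolume (hΩ : IsOpen Ω) (z : EuclideanSpace ℂ (Fin n)) :
    caratheodoryVolume Ω z ≤ kobayashiVolume Ω z := by
  refine sSup_le ?_
  rintro _ ⟨φ, hφ, hφz, rfl⟩
  refine le_sInf ?_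
  rintro _ ⟨ψ, hψ, hψ0, rfl⟩
  rw [ENNReal.le_div_iff_mul_le (Or.inr one_ne_zero) (Or.inr ENNReal.one_ne_top)]
  exact absJacobian_mul_le_one hΩ hφ hψ hφz hψ0

theorem absJacobian_ne_zero_of_fderiv_eq_smul {c : ℂ} (hc : c ≠ 0)
    (h : fderiv ℂ φ z = c • ContinuousLinearMap.id ℂ _) : absJacobian φ z ≠ 0 := by
  rw [absJacobian, h, enorm_ne_zero]
  have : (c • ContinuousLinearMap.id ℂ (EuclideanSpace ℂ (Fin n))).det =
      c ^ Module.finrank ℂ (EuclideanSpace ℂ (Fin n)) := by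
    rw [ContinuousLinearMap.det]
    simp
  rw [this]
  exact pow_ne_zero _ hc

theorem caratheodoryVolume_ne_zero (hbdd : Bornology.IsBounded Ω) (hz : z ∈ Ω) :
    caratheodoryVolume Ω z ≠ 0 := by
  obtain ⟨R, hR⟩ := hbdd.subset_ball z
  have hR0 : 0 < R := pos_of_mem_ball (hR hz)
  have hfd (x : EuclideanSpace ℂ (Fin n)) : HasFDerivAt (fun x => (R : ℂ)⁻¹ • (x - z))
      ((R : ℂ)⁻¹ • ContinuousLinearMap.id ℂ (EuclideanSpace ℂ (Fin n))) x :=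
    ((hasFDerivAt_id x).sub_const z).fun_const_smul _
  have hR' : (R : ℂ)⁻¹ ≠ 0 := inv_ne_zero (by exact_mod_cast hR0.ne')
  refine ne_bot_of_le_ne_bot (absJacobian_ne_zero_of_fderiv_eq_smul hR' (hfd z).fderiv)
    (le_sSup ⟨_, ⟨fun x _ => (hfd x).differentiableAt.differentiableWithinAt, fun x hx => ?_⟩,
      by simp, rfl⟩)
  have := hR hx
  rw [mem_ball, dist_eq_norm] at this
  rw [unitBall, mem_ball_zero_iff, norm_smul, norm_inv, Complex.norm_real, Real.norm_of_nonneg hR0.le,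
    inv_mul_lt_one₀ hR0]
  exact this

theorem kobayashiVolume_ne_top (hΩ : IsOpen Ω) (hz : z ∈ Ω) : kobayashiVolume Ω z ≠ ∞ := by
  obtain ⟨r, hr, hrΩ⟩ := Metric.isOpen_iff.1 hΩ z hz
  have hfd (x : EuclideanSpace ℂ (Fin n)) : HasFDerivAt (fun x => (r : ℂ) • x + z)
      ((r : ℂ) • ContinuousLinearMap.id ℂ (EuclideanSpace ℂ (Fin n))) x :=
    ((hasFDerivAt_id x).fun_const_smul _).add_const z
  have hr' : (r : ℂ) ≠ 0 := by exact_mod_cast hr.ne'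
  have hJ := absJacobian_ne_zero_of_fderiv_eq_smul hr' (hfd 0).fderiv
  refine ne_top_of_le_ne_top (ENNReal.div_ne_top ENNReal.one_ne_top hJ)
    (sInf_le ⟨_, ⟨fun x _ => (hfd x).differentiableAt.differentiableWithinAt, fun x hx => hrΩ ?_⟩,
      by simp, rfl⟩)
  rw [unitBall, mem_ball_zero_iff] at hx
  rw [mem_ball, dist_eq_norm, add_sub_cancel_right, norm_smul, Complex.norm_real,
    Real.norm_of_nonneg hr.le]
  exact mul_lt_of_lt_one_right hr hx

theorem one_le_quotientInvariant (hΩ : IsOpen Ω) (hbdd : Bornology.IsBounded Ω) (hz : z ∈ Ω) :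
    1 ≤ quotientInvariant Ω z := by
  rw [quotientInvariant, ENNReal.le_div_iff_mul_le (Or.inl (caratheodoryVolume_ne_zero hbdd hz))
    (Or.inr (kobayashiVolume_ne_top hΩ hz)), one_mul]
  exact caratheodoryVolume_le_kobayashiVolume hΩ z

/-- Replaces the supremum and infimum by approximating pairs; `𝒞 ≤ 𝒦`, `𝒞 ≠ 0` and `𝒦 ≠ ∞` make the
quotient meaningful. -/
theorem quotientInvariant_eq_one_iff (hΩ : IsOpen Ω) (hbdd : Bornology.IsBounded Ω) (hz : z ∈ Ω) :
    quotientInvariant Ω z = 1 ↔ ∀ e : ℝ≥0∞, e < 1 → ∃ φ ψ,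
      (IsHolomorphicMap Ω (unitBall n) φ ∧ φ z = 0) ∧
      (IsHolomorphicMap (unitBall n) Ω ψ ∧ ψ 0 = z) ∧ e < absJacobian φ z * absJacobian ψ 0 := by
  have hle := caratheodoryVolume_le_kobayashiVolume hΩ z
  have hC0 := caratheodoryVolume_ne_zero hbdd hz
  have hKtop := kobayashiVolume_ne_top hΩ hz
  have hCtop := ne_top_of_le_ne_top hKtop hle
  rw [quotientInvariant, ENNReal.div_eq_one_iff hC0 hCtop]
  constructor
  · intro hKC e he
    wlog he0 : e ≠ 0 generalizing e
    · obtain ⟨φ, ψ, hφ, hψ, h⟩ := this 2⁻¹ (by norm_num) (by norm_num)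
      exact ⟨φ, ψ, hφ, hψ, lt_of_le_of_lt (by simp [not_not.1 he0]) h⟩
    have hetop : e ≠ ∞ := ne_top_of_lt he
    have h1 : e * caratheodoryVolume Ω z < caratheodoryVolume Ω z := by
      simpa using ENNReal.mul_lt_mul_left hC0 hCtop he
    obtain ⟨_, ⟨φ, hφ, hφz, rfl⟩, h2⟩ := lt_sSup_iff.1 h1
    have h3 : kobayashiVolume Ω z < absJacobian φ z / e := by
      rw [ENNReal.lt_div_iff_mul_lt (Or.inl he0) (Or.inl hetop), mul_comm, hKC]
      exact h2
    obtain ⟨_, ⟨ψ, hψ, hψ0, rfl⟩, h4⟩ := sInf_lt_iff.1 h3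
    refine ⟨φ, ψ, ⟨hφ, hφz⟩, ⟨hψ, hψ0⟩, ?_⟩
    rw [ENNReal.lt_div_iff_mul_lt (Or.inl he0) (Or.inl hetop), mul_comm, mul_one_div,
      ENNReal.div_lt_iff (Or.inr he0) (Or.inr hetop)] at h4
    exact h4
  · intro H
    refine le_antisymm (ENNReal.le_of_forall_lt_one_mul_le fun e he => ?_) hle
    obtain ⟨φ, ψ, ⟨hφ, hφz⟩, ⟨hψ, hψ0⟩, h⟩ := H e he
    have h1 : absJacobian φ z ≤ caratheodoryVolume Ω z := le_sSup ⟨φ, hφ, hφz, rfl⟩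
    have h2 : kobayashiVolume Ω z ≤ 1 / absJacobian ψ 0 := sInf_le ⟨ψ, hψ, hψ0, rfl⟩
    rw [ENNReal.le_div_iff_mul_le (Or.inr one_ne_zero) (Or.inr ENNReal.one_ne_top)] at h2
    calc e * kobayashiVolume Ω z ≤ absJacobian φ z * absJacobian ψ 0 * kobayashiVolume Ω z := by
          gcongr
      _ = absJacobian φ z * (kobayashiVolume Ω z * absJacobian ψ 0) := by ring
      _ ≤ caratheodoryVolume Ω z * 1 := by gcongr
      _ = _ := mul_one _

end Volumes

/-! ### Recentring, and limits of the derivatives. -/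

section Transfer

variable {n : ℕ} {Ω : Set (EuclideanSpace ℂ (Fin n))}

/-- If `ψ ∘ φ : Ω → B → Ω` sends a point `y` near `z` to `z` with derivative close to the identity,
then maps centred at `z` with the analogous property exist. -/
theorem exists_centered_of_comp_near_id (hΩ : IsOpen Ω) {M : ℝ} (hbd : ∀ x ∈ Ω, ‖x‖ ≤ M)
    {φ ψ : EuclideanSpace ℂ (Fin n) → EuclideanSpace ℂ (Fin n)}
    (hφ : IsHolomorphicMap Ω (unitBall n) φ) (hψ : IsHolomorphicMap (unitBall n) Ω ψ)
    {z y : EuclideanSpace ℂ (Fin n)} {s ε : ℝ} (hs : 0 < s) (hsΩ : ball z s ⊆ Ω)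
    (hy : y ∈ ball z (s / 4)) (hyz : ψ (φ y) = z)
    (hε : ‖fderiv ℂ (ψ ∘ φ) y - 1‖ ≤ ε) :
    ∃ φ' ψ', (IsHolomorphicMap Ω (unitBall n) φ' ∧ φ' z = 0) ∧
      (IsHolomorphicMap (unitBall n) Ω ψ' ∧ ψ' 0 = z) ∧
      ‖fderiv ℂ ψ' 0 * fderiv ℂ φ' z - 1‖ ≤ ε + (64 * M / s ^ 2 + 4 / s) * ‖y - z‖ := by
  have hyΩ : y ∈ Ω := hsΩ (ball_subset_ball (by linarith) hy)
  have hzΩ : z ∈ Ω := hsΩ (mem_ball_self hs)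
  have ha : ‖φ y‖ < 1 := mem_ball_zero_iff.1 (hφ.2 hyΩ)
  -- `τ` exchanges `φ y` and `0`: thus `τ ∘ φ` vanishes at `y`, `ψ ∘ τ` sends `0` to `z`, and the
  -- composite is unchanged as `τ` is an involution.
  set τ := ballInvolution (φ y)
  have hτd : DifferentiableOn ℂ τ (unitBall n) := differentiableOn_ballInvolution ha
  have hτm : MapsTo τ (unitBall n) (unitBall n) := fun x hx =>
    mem_ball_zero_iff.2 (norm_ballInvolution_lt_one ha (mem_ball_zero_iff.1 hx))
  have hΦ : IsHolomorphicMap Ω (unitBall n) (τ ∘ φ) :=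
    ⟨hτd.comp hφ.1 hφ.2, hτm.comp hφ.2⟩
  have hΨ : IsHolomorphicMap (unitBall n) Ω (ψ ∘ τ) :=
    ⟨hψ.1.comp hτd hτm, hψ.2.comp hτm⟩
  have hΦy : (τ ∘ φ) y = 0 := ballInvolution_self ha
  have hΨ0 : (ψ ∘ τ) 0 = z := by
    simp only [τ, Function.comp_apply, ballInvolution_zero, hyz]
  have hΦbd : ∀ x ∈ ball z s, ‖(τ ∘ φ) x‖ ≤ 1 := fun x hx =>
    (mem_ball_zero_iff.1 (hΦ.2 (hsΩ hx))).le
  have hcomp : fderiv ℂ (ψ ∘ τ) 0 * fderiv ℂ (τ ∘ φ) y = fderiv ℂ (ψ ∘ φ) y := by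
    rw [← hΦy, ← fderiv_comp_eq_mul hΩ isOpen_ball hΨ.1 hΦ.1 hΦ.2 hyΩ]
    refine Filter.EventuallyEq.fderiv_eq ?_
    filter_upwards [hΩ.mem_nhds hyΩ] with x hx
    simp only [Function.comp_apply, τ]
    rw [ballInvolution_involutive_on_ball ha (mem_ball_zero_iff.1 (hφ.2 hx))]
  have hS : ‖fderiv ℂ (ψ ∘ τ) 0‖ ≤ 2 * M := by
    simpa using norm_fderiv_le_of_norm_le_on_ball one_pos hΨ.1 (fun x hx => hbd _ (hΨ.2 hx))
  have hyz4 : z ∈ ball z (s / 4) := mem_ball_self (by linarith)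
  have hR : ‖fderiv ℂ (τ ∘ φ) z - fderiv ℂ (τ ∘ φ) y‖ ≤ 32 / s ^ 2 * ‖y - z‖ := by
    have := norm_fderiv_sub_le_of_norm_le_on_ball hs (hΦ.1.mono hsΩ) hΦbd hy hyz4
    rwa [mul_one, norm_sub_rev z y] at this
  have hv : ‖(τ ∘ φ) z‖ ≤ 4 / s * ‖y - z‖ := by
    have := norm_sub_le_of_norm_le_on_ball hs (hΦ.1.mono hsΩ) hΦbd
      (ball_subset_ball (by linarith) hy) (ball_subset_ball (by linarith) hyz4)
    rwa [mul_one, hΦy, sub_zero, norm_sub_rev z y] at this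
  have hX : ‖fderiv ℂ (ψ ∘ τ) 0 * fderiv ℂ (τ ∘ φ) z - 1‖ ≤
      ε + 64 * M / s ^ 2 * ‖y - z‖ := by
    have hM : 0 ≤ M := (norm_nonneg _).trans (hbd z hzΩ)
    calc ‖fderiv ℂ (ψ ∘ τ) 0 * fderiv ℂ (τ ∘ φ) z - 1‖
        = ‖(fderiv ℂ (ψ ∘ φ) y - 1) +
          fderiv ℂ (ψ ∘ τ) 0 * (fderiv ℂ (τ ∘ φ) z - fderiv ℂ (τ ∘ φ) y)‖ := by
          rw [← hcomp, mul_sub]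
          congr 1
          abel
      _ ≤ ε + 2 * M * (32 / s ^ 2 * ‖y - z‖) := by
          refine (norm_add_le _ _).trans (add_le_add hε ((norm_mul_le _ _).trans ?_))
          gcongr
      _ = _ := by ring
  -- The map vanishes at `y`, not at `z`. Subtracting its small value `v` and dividing by `1 + ‖v‖`
  -- makes it vanish at `z` without leaving the ball.
  set v := (τ ∘ φ) z
  set c : ℝ := 1 + ‖v‖
  have hc : 1 ≤ c := by simp [c]
  have hc0 : 0 < c := by linarith
  have hcinv : ‖(c : ℂ)⁻¹‖ = c⁻¹ := by
    rw [norm_inv, Complex.norm_real, Real.norm_of_nonneg hc0.le]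
  have hfd : fderiv ℂ (fun x => (c : ℂ)⁻¹ • ((τ ∘ φ) x - v)) z =
      (c : ℂ)⁻¹ • fderiv ℂ (τ ∘ φ) z :=
    (((hΦ.1.differentiableAt (hΩ.mem_nhds hzΩ)).hasFDerivAt.sub_const v).fun_const_smul _).fderiv
  refine ⟨fun x => (c : ℂ)⁻¹ • ((τ ∘ φ) x - v), ψ ∘ τ, ⟨⟨?_, fun x hx => ?_⟩, ?_⟩,
    ⟨hΨ, hΨ0⟩, ?_⟩
  · exact (hΦ.1.sub_const v).fun_const_smul (c : ℂ)⁻¹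
  · have h1 : ‖(τ ∘ φ) x‖ < 1 := mem_ball_zero_iff.1 (hΦ.2 hx)
    rw [unitBall, mem_ball_zero_iff, norm_smul, hcinv, inv_mul_lt_one₀ hc0]
    exact (norm_sub_le _ _).trans_lt (by linarith)
  · simp [v]
  · have hc1 : c⁻¹ ≤ 1 := inv_le_one_of_one_le₀ hc
    have hc2 : 1 - c⁻¹ ≤ ‖v‖ := by
      have : 1 - c⁻¹ = ‖v‖ * c⁻¹ := by
        field_simp
        simp [c]
      rw [this]
      exact mul_le_of_le_one_right (norm_nonneg _) hc1
    rw [hfd, mul_smul_comm]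
    calc ‖(c : ℂ)⁻¹ • (fderiv ℂ (ψ ∘ τ) 0 * fderiv ℂ (τ ∘ φ) z) - 1‖
        = ‖(c : ℂ)⁻¹ • (fderiv ℂ (ψ ∘ τ) 0 * fderiv ℂ (τ ∘ φ) z - 1) -
            ((1 - c⁻¹ : ℝ) : ℂ) • (1 : EuclideanSpace ℂ (Fin n) →L[ℂ] _)‖ := by
          congr 1
          push_cast
          module
      _ ≤ c⁻¹ * ‖fderiv ℂ (ψ ∘ τ) 0 * fderiv ℂ (τ ∘ φ) z - 1‖ + (1 - c⁻¹) * 1 := by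
          refine (norm_sub_le _ _).trans ?_
          rw [norm_smul, norm_smul, hcinv, Complex.norm_real,
            Real.norm_of_nonneg (by linarith : (0 : ℝ) ≤ 1 - c⁻¹)]
          have : ‖(1 : EuclideanSpace ℂ (Fin n) →L[ℂ] EuclideanSpace ℂ (Fin n))‖ ≤ 1 :=
            ContinuousLinearMap.norm_id_le
          gcongr
      _ ≤ 1 * (ε + 64 * M / s ^ 2 * ‖y - z‖) + 4 / s * ‖y - z‖ := by
          refine add_le_add ?_ (by linarith)
          gcongr
      _ = _ := by ring

/-- Bounded sequences of operators whose products are contractions with determinant tending to `1`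
in modulus are, along some filter and after insertion of a fixed contraction, nearly inverse. -/
theorem exists_contraction_tendsto_one {E : Type*} [NormedAddCommGroup E] [InnerProductSpace ℂ E]
    [FiniteDimensional ℂ E] {R S : ℕ → E →L[ℂ] E} {C : ℝ} (hR : ∀ j, ‖R j‖ ≤ C)
    (hS : ∀ j, ‖S j‖ ≤ C) (hRS : ∀ j, ‖R j * S j‖ ≤ 1)
    (hdet : Tendsto (fun j => ‖(R j * S j).det‖) atTop (𝓝 1)) :
    ∃ (l : Filter ℕ) (U : E →L[ℂ] E), l.NeBot ∧ ‖U‖ ≤ 1 ∧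
      Tendsto (fun j => S j * (U * R j)) l (𝓝 1) := by
  have : ProperSpace (E →L[ℂ] E) := FiniteDimensional.proper ℂ _
  -- A single ultrafilter makes both bounded sequences converge, with no nested subsequences.
  have hcpt (T : ℕ → E →L[ℂ] E) (hT : ∀ j, ‖T j‖ ≤ C) :
      ∃ T₀, Tendsto T (hyperfilter ℕ : Filter ℕ) (𝓝 T₀) := by
    obtain ⟨T₀, -, h⟩ := (isCompact_closedBall (0 : E →L[ℂ] E) C).ultrafilter_le_nhds
      ((hyperfilter ℕ).map T) (by
        rw [le_principal_iff]
        exact Filter.Eventually.of_forall (f := (hyperfilter ℕ : Filter ℕ))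
          fun j => mem_closedBall_zero_iff.2 (hT j))
    exact ⟨T₀, h⟩
  obtain ⟨R₀, hR₀⟩ := hcpt R hR
  obtain ⟨S₀, hS₀⟩ := hcpt S hS
  have hA := hR₀.mul hS₀
  have hA1 : ‖R₀ * S₀‖ ≤ 1 := le_of_tendsto' hA.norm hRS
  have hAdet : ‖(R₀ * S₀).det‖ = 1 :=
    tendsto_nhds_unique
      (((ContinuousLinearMap.continuous_det (𝕜 := ℂ) (E := E)).tendsto _).comp hA).norm
      (hdet.mono_left (by rw [← Nat.cofinite_eq_atTop]; exact hyperfilter_le_cofinite))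
  have h1 := adjoint_mul_self_eq_one hA1 hAdet
  -- `U * R₀ * S₀ = 1`, and one-sided inverses are two-sided in finite dimension, so `S₀ * (U * R₀)
  -- = 1`.
  set U := ContinuousLinearMap.adjoint (R₀ * S₀)
  have hfin {X Y : E →L[ℂ] E} (h : X * Y = 1) : Y * X = 1 := by
    have h' : (X : E →ₗ[ℂ] E) * (Y : E →ₗ[ℂ] E) = 1 := by
      rw [← ContinuousLinearMap.toLinearMap_mul, h]; rfl
    have h'' := mul_eq_one_comm.1 h'
    ext x
    exact congrArg (fun f : E →ₗ[ℂ] E => f x) h''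
  have h2 : S₀ * (U * R₀) = 1 := hfin (by rw [mul_assoc, h1])
  refine ⟨_, U, inferInstance, ?_, h2 ▸ hS₀.mul (tendsto_const_nhds.mul hR₀)⟩
  exact (LinearIsometryEquiv.norm_map ContinuousLinearMap.adjoint _).trans_le hA1

end Transfer

/-! ### Carrying the value one from `P` to `z`. -/

section Main

variable {n : ℕ} {Ω : Set (EuclideanSpace ℂ (Fin n))}

theorem quotientInvariant_eq_one_of_eq_one (hΩ : IsOpen Ω) (hconn : IsConnected Ω)
    (hbdd : Bornology.IsBounded Ω) {P z : EuclideanSpace ℂ (Fin n)} (hP : P ∈ Ω) (hz : z ∈ Ω)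
    (h : quotientInvariant Ω P = 1) : quotientInvariant Ω z = 1 := by
  rw [quotientInvariant_eq_one_iff hΩ hbdd hP] at h
  obtain ⟨M, hM⟩ := hbdd.exists_norm_le
  have hM0 : 0 ≤ M := (norm_nonneg P).trans (hM P hP)
  -- nearly extremal pairs at `P`
  have hlt (j : ℕ) : (ENNReal.ofReal (1 - 1 / ((j : ℝ) + 1))) < 1 := by
    rw [← ENNReal.ofReal_one, ENNReal.ofReal_lt_ofReal_iff one_pos]
    have : (0 : ℝ) < 1 / ((j : ℝ) + 1) := by positivity
    linarith
  choose φ ψ hφ hψ hφψ using fun j : ℕ => h _ (hlt j)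
  obtain ⟨r, hr, hrΩ⟩ := Metric.isOpen_iff.1 hΩ P hP
  have hR (j : ℕ) : ‖fderiv ℂ (φ j) P‖ ≤ max (2 * 1 / r) (2 * M / 1) :=
    (norm_fderiv_le_of_norm_le_on_ball hr ((hφ j).1.1.mono hrΩ) fun x hx =>
      (mem_ball_zero_iff.1 ((hφ j).1.2 (hrΩ hx))).le).trans (le_max_left _ _)
  have hS (j : ℕ) : ‖fderiv ℂ (ψ j) 0‖ ≤ max (2 * 1 / r) (2 * M / 1) :=
    (norm_fderiv_le_of_norm_le_on_ball one_pos (hψ j).1.1 fun x hx =>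
      hM _ ((hψ j).1.2 hx)).trans (le_max_right _ _)
  have hRS (j : ℕ) : ‖fderiv ℂ (φ j) P * fderiv ℂ (ψ j) 0‖ ≤ 1 :=
    norm_fderiv_mul_fderiv_le_one hΩ (hφ j).1 (hψ j).1 (hφ j).2 (hψ j).2
  have hdet : Tendsto (fun j => ‖(fderiv ℂ (φ j) P * fderiv ℂ (ψ j) 0).det‖) atTop (𝓝 1) := by
    have hlow : Tendsto (fun j : ℕ => 1 - 1 / ((j : ℝ) + 1)) atTop (𝓝 1) := by
      simpa using tendsto_one_div_add_atTop_nhds_zero_nat.const_sub (1 : ℝ)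
    refine tendsto_of_tendsto_of_tendsto_of_le_of_le hlow tendsto_const_nhds (fun j => ?_)
      (fun j => norm_det_le_one (hRS j))
    have := hφψ j
    rw [absJacobian_mul_absJacobian, ← ofReal_norm] at this
    exact (ENNReal.ofReal_lt_ofReal_iff'.1 this).1.le
  obtain ⟨l, U, hl, hU, hlim⟩ := exists_contraction_tendsto_one hR hS hRS hdet
  have hUm : MapsTo U (unitBall n) (unitBall n) := fun x hx => by
    rw [unitBall, mem_ball_zero_iff] at *
    exact (U.le_of_opNorm_le hU x).trans_lt (by rwa [one_mul])
  have hΨ (j : ℕ) : IsHolomorphicMap (unitBall n) Ω (ψ j ∘ U) :=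
    ⟨(hψ j).1.1.comp U.differentiable.differentiableOn hUm, (hψ j).1.2.comp hUm⟩
  set H : ℕ → EuclideanSpace ℂ (Fin n) → EuclideanSpace ℂ (Fin n) := fun j => (ψ j ∘ U) ∘ φ j
  have hHd (j : ℕ) : DifferentiableOn ℂ (H j) Ω := (hΨ j).1.comp (hφ j).1.1 (hφ j).1.2
  have hHm (j : ℕ) : MapsTo (H j) Ω Ω := (hΨ j).2.comp (hφ j).1.2
  have hHP (j : ℕ) : H j P = P := by simp [H, (hφ j).2, (hψ j).2]
  have hHfd (j : ℕ) : fderiv ℂ (H j) P = fderiv ℂ (ψ j) 0 * (U * fderiv ℂ (φ j) P) := by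
    have h1 := fderiv_comp_eq_mul hΩ isOpen_ball (hΨ j).1 (hφ j).1.1 (hφ j).1.2 hP
    have h2 := fderiv_comp_eq_mul isOpen_ball isOpen_ball (hψ j).1.1
      U.differentiable.differentiableOn hUm (zero_mem_unitBall n)
    rw [h1, (hφ j).2, h2, map_zero, U.fderiv, mul_assoc]
  have hnearP := uniform_near_id_of_fderiv_tendsto_one hΩ hM hP hHd hHm hHP
    (by simpa only [hHfd] using hlim)
  obtain ⟨s₁, hs₁, hnear⟩ := uniform_small_near_of_isPreconnected hΩ hconn.isPreconnected
    (by positivity : 0 ≤ 2 * M) (f := fun j x => H j x - x)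
    (fun j => (hHd j).sub differentiableOn_id)
    (fun j x hx => (norm_sub_le _ _).trans (by linarith [hM x hx, hM _ (hHm j hx)]))
    hP hnearP hz
  obtain ⟨s₂, hs₂, hs₂Ω⟩ := Metric.isOpen_iff.1 hΩ z hz
  obtain ⟨s, hs, hs1, hs2⟩ : ∃ s > 0, s ≤ s₁ ∧ s ≤ s₂ :=
    ⟨min s₁ s₂, lt_min hs₁ hs₂, min_le_left _ _, min_le_right _ _⟩
  have hsΩ : ball z s ⊆ Ω := (ball_subset_ball hs2).trans hs₂Ω
  rw [quotientInvariant_eq_one_iff hΩ hbdd hz]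
  intro e he
  -- operators close to the identity have determinant of modulus larger than `e`
  obtain ⟨ε, hε, hεe⟩ : ∃ ε > 0, ∀ T : EuclideanSpace ℂ (Fin n) →L[ℂ] EuclideanSpace ℂ (Fin n),
      ‖T - 1‖ < ε → e < ‖T.det‖ₑ := by
    have hcont : Continuous fun T : EuclideanSpace ℂ (Fin n) →L[ℂ] EuclideanSpace ℂ (Fin n) =>
        ‖T.det‖ₑ := ContinuousLinearMap.continuous_det.enorm
    have h1 : e < ‖(1 : EuclideanSpace ℂ (Fin n) →L[ℂ] EuclideanSpace ℂ (Fin n)).det‖ₑ := by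
      have : (1 : EuclideanSpace ℂ (Fin n) →L[ℂ] EuclideanSpace ℂ (Fin n)).det = 1 :=
        LinearMap.det_id
      simpa [this] using he
    obtain ⟨ε, hε, H⟩ := Metric.eventually_nhds_iff.1 (hcont.continuousAt.eventually_const_lt h1)
    exact ⟨ε, hε, fun T hT => H (by rwa [dist_eq_norm])⟩
  -- Total error per unit of `η`: the derivative of `H j` at `y` is off by `4 / s * η`, and
  -- recentring pays for `‖y - z‖ ≤ 2 * η`.
  set K : ℝ := 4 / s + (64 * M / s ^ 2 + 4 / s) * 2
  have hK : 0 < K := by positivity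
  obtain ⟨η, hη, hηs, hηε⟩ : ∃ η > 0, 8 * η < s ∧ K * η < ε := by
    refine ⟨min (s / 16) (ε / (2 * K)), by positivity, ?_, ?_⟩
    · linarith [min_le_left (s / 16) (ε / (2 * K))]
    · calc K * min (s / 16) (ε / (2 * K)) ≤ K * (ε / (2 * K)) := by
            gcongr
            exact min_le_right _ _
        _ = ε / 2 := by field_simp
        _ < ε := half_lt_self hε
  obtain ⟨j, hj⟩ := (hnear η hη).exists
  have hj' : ∀ x ∈ ball z s, ‖H j x - x‖ ≤ η := fun x hx => hj x (ball_subset_ball hs1 hx)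
  obtain ⟨y, hyz, hy⟩ := exists_eq_center_of_near_id hs hηs ((hHd j).mono hsΩ) hj'
  have hyη : ‖y - z‖ ≤ 2 * η := hyz.trans (by linarith [hj' z (mem_ball_self hs)])
  have hyb : y ∈ ball z (s / 4) := by
    rw [mem_ball, dist_eq_norm]
    linarith
  have hsub : ball y (s / 2) ⊆ ball z s := ball_subset_ball' (by linarith [mem_ball.1 hyb])
  have hfd : ‖fderiv ℂ (H j) y - 1‖ ≤ 4 / s * η := by
    have h1 := norm_fderiv_le_of_norm_le_on_ball (f := fun x => H j x - x) (half_pos hs)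
      (((hHd j).mono (hsub.trans hsΩ)).sub differentiableOn_id) (fun x hx => hj' x (hsub hx))
    have h2 : HasFDerivAt (fun x => H j x - x) (fderiv ℂ (H j) y - 1) y :=
      ((hHd j).differentiableAt
        (hΩ.mem_nhds (hsΩ (hsub (mem_ball_self (half_pos hs)))))).hasFDerivAt.sub (hasFDerivAt_id y)
    rw [h2.fderiv] at h1
    refine h1.trans_eq ?_
    field_simp
    norm_num
  obtain ⟨φ', ψ', hφ', hψ', hest⟩ :=
    exists_centered_of_comp_near_id hΩ hM (hφ j).1 (hΨ j) hs hsΩ hyb hy hfd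
  refine ⟨φ', ψ', hφ', hψ', ?_⟩
  rw [mul_comm, absJacobian_mul_absJacobian]
  refine hεe _ (hest.trans_lt (lt_of_le_of_lt ?_ hηε))
  calc 4 / s * η + (64 * M / s ^ 2 + 4 / s) * ‖y - z‖
      ≤ 4 / s * η + (64 * M / s ^ 2 + 4 / s) * (2 * η) := by gcongr
    _ = K * η := by ring

end Main

theorem proposition3 (n : ℕ) (Ω : Set (EuclideanSpace ℂ (Fin n)))
    (hopen : IsOpen Ω) (hconn : IsConnected Ω) (hbdd : Bornology.IsBounded Ω) :
    ((∃ P ∈ Ω, quotientInvariant Ω P = 1) → ∀ z ∈ Ω, quotientInvariant Ω z = 1) ∧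
    ((∃ P ∈ Ω, 1 < quotientInvariant Ω P) → ∀ z ∈ Ω, 1 < quotientInvariant Ω z) ∧
    ((∀ z ∈ Ω, quotientInvariant Ω z = 1) ∨ (∀ z ∈ Ω, 1 < quotientInvariant Ω z)) := by
  have hone : (∃ P ∈ Ω, quotientInvariant Ω P = 1) → ∀ z ∈ Ω, quotientInvariant Ω z = 1 :=
    fun ⟨_, hP, h⟩ _ hz => quotientInvariant_eq_one_of_eq_one hopen hconn hbdd hP hz h
  have hlt (z) (hz : z ∈ Ω) (h : quotientInvariant Ω z ≠ 1) : 1 < quotientInvariant Ω z :=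
    lt_of_le_of_ne (one_le_quotientInvariant hopen hbdd hz) h.symm
  refine ⟨hone, ?_, ?_⟩
  · rintro ⟨P, hP, h⟩ z hz
    exact hlt z hz fun h1 => h.ne' (hone ⟨z, hz, h1⟩ P hP)
  · by_cases h : ∃ P ∈ Ω, quotientInvariant Ω P = 1
    · exact Or.inl (hone h)
    · exact Or.inr fun z hz => hlt z hz fun h1 => h ⟨z, hz, h1⟩
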